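/- Let $\xi_1,\xi_2,\ldots$ be independent identically distributed random variables with values in $\{0,1,2,\ldots\}$, $\mathbf P(\xi_1=i)=p_i>0$ for all $i\ge 0$, $\sum_{i\ge 0}p_i=1$. Put $\bar\xi_n=\max_{1\le i\le n}\xi_i$ for $n\ge 1$, $R(n)=-\ln\sum_{i\ge n}p_i$ for $n\ge 0$, $r(n)=R(n)-R(n-1)$ for $n\ge 1$, and $a_n=\max\{k\ge 0:\sum_{i\ge k}p_i\ge 1/n\}$ for $n\ge 1$. Suppose that $r(n)$, $n\ge1$, is a monotonic (hence non-decreasing) function of $n$ and that $r(n)\to\infty$ as $n\to\infty$. Let $l\ge 1$ be a fixed integer; "i.o." means "for infinitely many $n$". Then: (i) if $l=1$, then $\mathbf P(\bar\xi_n\le a_n-1\ \text{i.o.})=1$; (ii) if $l>1$, then $\mathbf P(\bar\xi_n\le a_n-l\ \text{i.o.})$ equals $0$ if the series $\sum_{k\ge 1}\exp\bigl(-\exp((l-1)\,r(k))\bigr)$ converges, and equals $1$ if it diverges. -/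

import Mathlib

open MeasureTheory ProbabilityTheory Filter Topology

noncomputable section

/-- The tail `P(ξ ≥ n) = ∑_{i ≥ n} p_i` of the distribution `(i, p_i)`, `i ≥ 0`. -/
def tail (p : ℕ → ℝ) (n : ℕ) : ℝ := ∑' i : ℕ, p (n + i)

/-- `R(n) = -ln P(ξ ≥ n)`. -/
def bigR (p : ℕ → ℝ) (n : ℕ) : ℝ := -Real.log (tail p n)

/-- `r(n) = R(n) - R(n-1)`, of interest for `n ≥ 1`. The value at `n = 0` is
`0`, which is also the value of `R(0) - R(-1)` since `P(ξ ≥ 0) = P(ξ ≥ -1) = 1`. -/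
def smallR (p : ℕ → ℝ) (n : ℕ) : ℝ := bigR p n - bigR p (n - 1)

/-- `a_n = max {k ≥ 0 : ∑_{i ≥ k} p_i ≥ 1/n}`, for `n ≥ 1`
(the maximum is attained, see `isGreatest_levelA`). -/
def levelA (p : ℕ → ℝ) (n : ℕ) : ℕ := sSup {k : ℕ | 1 / (n : ℝ) ≤ tail p k}

/-- The maximum of the first `n` variables of the sequence. The sequence is indexed from `0`:
`X i` is the variable `ξ_{i+1}`, so this is `max_{1 ≤ i ≤ n} ξ_i` for `n ≥ 1`. -/
def partialMax {Ω : Type*} (X : ℕ → Ω → ℕ) (n : ℕ) (ω : Ω) : ℕ :=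
  (Finset.range n).sup (fun i => X i ω)

/-- The supremum that defines `levelA` is a maximum when `n ≥ 1`. -/
theorem isGreatest_levelA {p : ℕ → ℝ} (hp : HasSum p 1) {n : ℕ} (hn : 1 ≤ n) :
    IsGreatest {k : ℕ | 1 / (n : ℝ) ≤ tail p k} (levelA p n) := by
  have hn' : (1 : ℝ) ≤ n := by exact_mod_cast hn
  have hne : {k : ℕ | 1 / (n : ℝ) ≤ tail p k}.Nonempty := by
    refine ⟨0, ?_⟩
    have h0 : tail p 0 = 1 := by simp [tail, hp.tsum_eq]
    change 1 / (n : ℝ) ≤ tail p 0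
    rw [h0]
    exact (div_le_one (by linarith)).2 hn'
  have hbdd : BddAbove {k : ℕ | 1 / (n : ℝ) ≤ tail p k} := by
    have ht : Tendsto (tail p) atTop (𝓝 0) := by
      have := tendsto_sum_nat_add p
      refine this.congr fun k => ?_
      simp only [tail, add_comm]
    obtain ⟨N, hN⟩ := eventually_atTop.1
      (ht.eventually (gt_mem_nhds (show (0 : ℝ) < 1 / n by positivity)))
    refine ⟨N, fun k hk => ?_⟩
    by_contra hlt
    exact absurd (hN k (by omega)) (not_lt.2 hk)
  exact ⟨Nat.sSup_mem hne hbdd, fun k hk => le_csSup hbdd hk⟩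

end

/-! Write t_m for the tail, d = l - 1 and n_k = ⌈1 / t_k⌉, the first n with a_n ≥ k. The maximum
grows with n while a_n is constant between consecutive values of n_k, so only the times n_k matter:
the event is that A_m = {the first n_{m+d} variables are below m} occurs for infinitely many m
(`frequently_partialMax_le_iff`).

By independence P(A_m) = (1 - t_m)^{n_{m+d}}, roughly exp(-t_m / t_{m+d}) = exp(-exp(R(m+d) -
R(m))). Monotonicity of r puts R(m+d) - R(m) between d r(m+1) and d r(m+d), so for d ≥ 1 the series
of P(A_m) and the given series converge or diverge together (`one_sub_tail_pow_le`,
`not_summable_one_sub_tail_pow`). For d = 0 the P(A_m) stay away from 0.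

Convergence gives probability 0 by Borel–Cantelli. Under divergence the A_m are quasi-independent at
distance at least d, so Kochen–Stone gives positive probability, and the tail zero-one law lifts it
to 1. -/

/-! ### Tails and increments of R -/

section Tail

variable {p : ℕ → ℝ}

theorem tail_zero (hp : HasSum p 1) : tail p 0 = 1 := by simp [tail, hp.tsum_eq]

theorem sum_range_add_tail (hp : HasSum p 1) (m : ℕ) :
    ∑ k ∈ Finset.range m, p k + tail p m = 1 := by
  have h := hp.summable.sum_add_tsum_nat_add m
  rw [hp.tsum_eq] at h
  simpa [tail, add_comm] using h

theorem tail_succ (hp : HasSum p 1) (m : ℕ) : tail p (m + 1) = tail p m - p m := by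
  have h := sum_range_add_tail hp m
  have h' := sum_range_add_tail hp (m + 1)
  rw [Finset.sum_range_succ] at h'
  linarith

theorem tail_pos (hp_pos : ∀ i, 0 < p i) (hp : HasSum p 1) (m : ℕ) : 0 < tail p m := by
  have hs : Summable fun i => p (m + i) := by
    simpa [add_comm] using (summable_nat_add_iff m).2 hp.summable
  exact hs.tsum_pos (fun i => (hp_pos _).le) 0 (hp_pos _)

theorem tail_antitone (hp_pos : ∀ i, 0 < p i) (hp : HasSum p 1) : Antitone (tail p) :=
  antitone_nat_of_succ_le fun m => by
    rw [tail_succ hp]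
    linarith [hp_pos m]

theorem tail_le_one (hp_pos : ∀ i, 0 < p i) (hp : HasSum p 1) (m : ℕ) : tail p m ≤ 1 :=
  (tail_antitone hp_pos hp (Nat.zero_le m)).trans_eq (tail_zero hp)

theorem tendsto_tail_zero (p : ℕ → ℝ) : Tendsto (tail p) atTop (𝓝 0) :=
  (tendsto_sum_nat_add p).congr fun k => by simp only [tail, add_comm]

theorem bigR_add_sub_ge (hr : MonotoneOn (smallR p) (Set.Ici 1)) (m d : ℕ) :
    (d : ℝ) * smallR p (m + 1) ≤ bigR p (m + d) - bigR p m := by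
  induction d with
  | zero => simp
  | succ d ih =>
    have h : smallR p (m + 1) ≤ smallR p (m + d + 1) :=
      hr (by simp) (by simp) (by omega)
    have h' : smallR p (m + d + 1) = bigR p (m + d + 1) - bigR p (m + d) := rfl
    rw [← add_assoc]
    push_cast
    linarith

theorem bigR_add_sub_le (hr : MonotoneOn (smallR p) (Set.Ici 1)) (m : ℕ) {d D : ℕ} (hd : d ≤ D) :
    bigR p (m + d) - bigR p m ≤ (d : ℝ) * smallR p (m + D) := by
  induction d with
  | zero => simp
  | succ d ih =>
    have h : smallR p (m + d + 1) ≤ smallR p (m + D) :=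
      hr (by simp) (by simp only [Set.mem_Ici]; omega) (by omega)
    have h' : smallR p (m + d + 1) = bigR p (m + d + 1) - bigR p (m + d) := rfl
    have := ih (by omega)
    rw [← add_assoc]
    push_cast
    linarith

theorem tail_div_tail (hp_pos : ∀ i, 0 < p i) (hp : HasSum p 1) (m k : ℕ) :
    tail p m / tail p k = Real.exp (bigR p k - bigR p m) := by
  have hm := tail_pos hp_pos hp m
  have hk := tail_pos hp_pos hp k
  rw [← Real.exp_log (div_pos hm hk), Real.log_div hm.ne' hk.ne']
  congr 1
  simp only [bigR]
  ring

/-- If `r` tends to infinity then the tail decays so fast that `(m + 1) P(ξ ≥ m)` is bounded. -/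
theorem exists_bound_mul_tail (hp_pos : ∀ i, 0 < p i) (hp : HasSum p 1)
    (hr : Tendsto (smallR p) atTop atTop) :
    ∃ B : ℝ, ∀ᶠ m : ℕ in atTop, ((m : ℝ) + 1) * tail p m ≤ B := by
  obtain ⟨K, hK⟩ := eventually_atTop.1 (hr.eventually_ge_atTop 1)
  refine ⟨((K : ℝ) + 1) * tail p K, eventually_atTop.2 ⟨K, fun m hm => ?_⟩⟩
  induction m, hm using Nat.le_induction with
  | base => exact le_rfl
  | succ m hm ih =>
    refine le_trans ?_ ih
    -- Once r ≥ 1, each step at least halves the tail, which outweighs m + 2 ≤ 2 (m + 1).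
    have h1 : (2 : ℝ) ≤ tail p m / tail p (m + 1) := by
      rw [tail_div_tail hp_pos hp]
      have h2 : 1 ≤ bigR p (m + 1) - bigR p m := hK (m + 1) (by omega)
      linarith [Real.add_one_le_exp (bigR p (m + 1) - bigR p m)]
    rw [le_div_iff₀ (tail_pos hp_pos hp _)] at h1
    have h3 := tail_pos hp_pos hp (m + 1)
    have h4 : (0 : ℝ) ≤ m := m.cast_nonneg
    push_cast
    nlinarith [mul_nonneg h4 h3.le]

end Tail

/-! ### Exponential lower bounds for powers of 1 - x -/

theorem exp_neg_div_le_one_sub {x : ℝ} (hx : x < 1) : Real.exp (-(x / (1 - x))) ≤ 1 - x := by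
  have h : 0 < 1 - x := by linarith
  have h1 := Real.one_sub_inv_le_log_of_pos h
  rw [← Real.le_log_iff_exp_le h]
  refine le_trans (le_of_eq ?_) h1
  field_simp
  ring

/-- `(1 - x) ^ N` is at least `exp (-(N x + 2 N x²))` for `x ≤ 1 / 2`. -/
theorem exp_neg_le_one_sub_pow {x : ℝ} (hx0 : 0 ≤ x) (hx : x ≤ 1 / 2) (N : ℕ) :
    Real.exp (-(N * x + 2 * (N * x) * x)) ≤ (1 - x) ^ N := by
  refine le_trans ?_ (pow_le_pow_left₀ (Real.exp_nonneg _) (exp_neg_div_le_one_sub (by linarith)) N)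
  rw [← Real.exp_nat_mul, Real.exp_le_exp]
  have h : x / (1 - x) ≤ x + 2 * x * x := by
    rw [div_le_iff₀ (by linarith)]
    nlinarith [mul_nonneg hx0 hx0, mul_nonneg (mul_nonneg hx0 hx0) (sub_nonneg.2 hx)]
  nlinarith [mul_le_mul_of_nonneg_left h (N.cast_nonneg (α := ℝ))]

/-- The first `n` with `levelA p n ≥ k`. -/
noncomputable def levelStart (p : ℕ → ℝ) (k : ℕ) : ℕ := ⌈1 / tail p k⌉₊

/-! ### Level times and comparison of the two series -/

section LevelStart

variable {p : ℕ → ℝ}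

/-- Both sides say 1 / n ≤ t_k, because the tail is antitone. This Galois correspondence trades a_n
for the times n_k. -/
theorem le_levelA_iff (hp_pos : ∀ i, 0 < p i) (hp : HasSum p 1) {n : ℕ} (hn : 1 ≤ n) (k : ℕ) :
    k ≤ levelA p n ↔ levelStart p k ≤ n := by
  have hn' : (0 : ℝ) < n := by exact_mod_cast hn
  have hg := isGreatest_levelA hp hn
  have h1 : levelStart p k ≤ n ↔ 1 / (n : ℝ) ≤ tail p k := by
    rw [levelStart, Nat.ceil_le, one_div_le (tail_pos hp_pos hp k) hn']
  rw [h1]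
  exact ⟨fun h => le_trans hg.1 (tail_antitone hp_pos hp h), fun h => hg.2 h⟩

theorem one_div_tail_le_levelStart (p : ℕ → ℝ) (k : ℕ) : 1 / tail p k ≤ levelStart p k :=
  Nat.le_ceil _

theorem levelStart_le (hp_pos : ∀ i, 0 < p i) (hp : HasSum p 1) (k : ℕ) :
    (levelStart p k : ℝ) ≤ 1 / tail p k + 1 :=
  (Nat.ceil_lt_add_one (one_div_pos.2 (tail_pos hp_pos hp k)).le).le

theorem levelStart_mono (hp_pos : ∀ i, 0 < p i) (hp : HasSum p 1) : Monotone (levelStart p) :=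
  fun _ _ h => Nat.ceil_mono
    (one_div_le_one_div_of_le (tail_pos hp_pos hp _) (tail_antitone hp_pos hp h))

theorem levelStart_pos (hp_pos : ∀ i, 0 < p i) (hp : HasSum p 1) (k : ℕ) : 1 ≤ levelStart p k :=
  Nat.ceil_pos.2 (one_div_pos.2 (tail_pos hp_pos hp k))

theorem tendsto_levelStart (hp_pos : ∀ i, 0 < p i) (hp : HasSum p 1) :
    Tendsto (levelStart p) atTop atTop := by
  have h : Tendsto (fun k => 1 / tail p k) atTop atTop := by
    simp only [one_div]
    exact Tendsto.inv_tendsto_nhdsGT_zero (tendsto_nhdsWithin_iff.2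
      ⟨tendsto_tail_zero p, Eventually.of_forall fun k => tail_pos hp_pos hp k⟩)
  exact tendsto_nat_ceil_atTop.comp h

/-- `(1 - P(ξ ≥ m)) ^ N` stays away from `0` as long as `N ≤ 1 / P(ξ ≥ k) + 1`, `k ≤ m`. -/
theorem exp_neg_four_le_one_sub_tail_pow (hp_pos : ∀ i, 0 < p i) (hp : HasSum p 1) {k m : ℕ}
    (hkm : k ≤ m) (hm : tail p m ≤ 1 / 2) :
    Real.exp (-4) ≤ (1 - tail p m) ^ levelStart p k := by
  have h0 := tail_pos hp_pos hp m
  refine le_trans ?_ (exp_neg_le_one_sub_pow h0.le hm _)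
  -- The ceiling adds at most t_m ≤ 1/2 to 1. The exponent is then at most 3/2 + 3/2 = 3, so 4 is
  -- ample.
  have h1 : levelStart p k * tail p m ≤ 3 / 2 := by
    have h2 := mul_le_mul_of_nonneg_right (levelStart_le hp_pos hp k) h0.le
    have h3 : 1 / tail p k * tail p m ≤ 1 := by
      rw [one_div, inv_mul_le_iff₀ (tail_pos hp_pos hp k), mul_one]
      exact tail_antitone hp_pos hp hkm
    linarith
  have h2 : 0 ≤ levelStart p k * tail p m := by positivity
  rw [Real.exp_le_exp]
  nlinarith

/-- From 1 - x ≤ exp(-x), n_{m+d} ≥ 1 / t_{m+d} and the lower bound d r(m+1) for R(m+d) - R(m). -/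
theorem one_sub_tail_pow_le (hp_pos : ∀ i, 0 < p i) (hp : HasSum p 1)
    (hr : MonotoneOn (smallR p) (Set.Ici 1)) (m d : ℕ) :
    (1 - tail p m) ^ levelStart p (m + d) ≤ Real.exp (-Real.exp (d * smallR p (m + 1))) := by
  have h0 := tail_pos hp_pos hp m
  refine le_trans (pow_le_pow_left₀ (by linarith [tail_le_one hp_pos hp m])
    (Real.one_sub_le_exp_neg _) _) ?_
  rw [← Real.exp_nat_mul, Real.exp_le_exp]
  have h1 := mul_le_mul_of_nonneg_right (one_div_tail_le_levelStart p (m + d)) h0.le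
  have h2 : 1 / tail p (m + d) * tail p m = Real.exp (bigR p (m + d) - bigR p m) := by
    rw [← tail_div_tail hp_pos hp]
    ring
  have h3 := Real.exp_le_exp.2 (bigR_add_sub_ge hr m d)
  linarith

/-- Replacing (1 - t)^N by exp(-N t) costs about N t² in the exponent. This cost is bounded unless
exp(-z), with z = exp(d r(m+d)), is already below the term of a convergent series. -/
theorem not_summable_one_sub_tail_pow (hp_pos : ∀ i, 0 < p i) (hp : HasSum p 1)
    (hr : MonotoneOn (smallR p) (Set.Ici 1)) (hr' : Tendsto (smallR p) atTop atTop)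
    {d : ℕ} (hd : 1 ≤ d)
    (h : ¬ Summable fun k : ℕ => Real.exp (-Real.exp (d * smallR p (k + 1)))) :
    ¬ Summable fun m => (1 - tail p m) ^ levelStart p (m + d) := by
  intro hs
  apply h
  -- The shift turns r(k+1) into r(m+d), the upper end of the bound on R(m+d) - R(m).
  rw [← summable_nat_add_iff (d - 1)]
  obtain ⟨B, hB⟩ := exists_bound_mul_tail hp_pos hp hr'
  have hsq : Summable fun m : ℕ => 1 / ((m : ℝ) + 1) ^ 2 := by
    have := (summable_nat_add_iff 1).2 (Real.summable_one_div_nat_pow.2 one_lt_two)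
    simpa using this
  refine Summable.of_norm_bounded_eventually_nat
    -- With N t ≤ z + t, the exponent N t + 2 N t² exceeds z by at most t + 2 t² ≤ 1 plus 2 z t ≤ 4
    -- B.
    ((hs.mul_left (Real.exp (1 + 4 * B))).add hsq) ?_
  filter_upwards [hB, (tendsto_tail_zero p).eventually_le_const (by norm_num : (0 : ℝ) < 1 / 2)]
    with m hmB hm
  rw [Real.norm_of_nonneg (Real.exp_nonneg _), show m + (d - 1) + 1 = m + d by omega]
  have h0 := tail_pos hp_pos hp m
  have hpow : 0 ≤ (1 - tail p m) ^ levelStart p (m + d) := pow_nonneg (by linarith) _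
  have hm1 : (0 : ℝ) < (m : ℝ) + 1 := by positivity
  set z := Real.exp (d * smallR p (m + d)) with hz
  have hz0 : 0 < z := Real.exp_pos _
  rcases le_or_gt z (2 * Real.log ((m : ℝ) + 1)) with hzl | hzl
  · have h1 : z * tail p m ≤ 2 * B := by
      have h2 : z ≤ 2 * ((m : ℝ) + 1) := by
        have := Real.log_le_sub_one_of_pos hm1
        linarith
      nlinarith
    have hN : levelStart p (m + d) * tail p m ≤ z + tail p m := by
      have h3 := mul_le_mul_of_nonneg_right (levelStart_le hp_pos hp (m + d)) h0.le
      have h4 : 1 / tail p (m + d) * tail p m = Real.exp (bigR p (m + d) - bigR p m) := by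
        rw [← tail_div_tail hp_pos hp]
        ring
      have h5 := Real.exp_le_exp.2 (bigR_add_sub_le hr m (le_refl d))
      linarith
    have h6 : Real.exp (-z) ≤
        Real.exp (1 + 4 * B) * (1 - tail p m) ^ levelStart p (m + d) := by
      refine le_trans ?_ (mul_le_mul_of_nonneg_left
        (exp_neg_le_one_sub_pow h0.le hm (levelStart p (m + d))) (Real.exp_nonneg _))
      rw [← Real.exp_add, Real.exp_le_exp]
      have h7 := mul_le_mul_of_nonneg_right hN h0.le
      nlinarith
    have h8 : 0 ≤ 1 / ((m : ℝ) + 1) ^ 2 := by positivity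
    linarith
  · have h1 : Real.exp (-z) ≤ 1 / ((m : ℝ) + 1) ^ 2 := by
      calc Real.exp (-z) ≤ Real.exp (-(2 * Real.log ((m : ℝ) + 1))) :=
            Real.exp_le_exp.2 (by linarith)
        _ = 1 / ((m : ℝ) + 1) ^ 2 := by
            rw [Real.exp_neg, two_mul, Real.exp_add, Real.exp_log hm1, one_div, sq]
    have h2 := mul_nonneg (Real.exp_nonneg (1 + 4 * B)) hpow
    linarith

end LevelStart

/-! ### Second moment method and Kochen–Stone -/

section SecondMoment

variable {Ω : Type*} [MeasurableSpace Ω] {P : Measure Ω} [IsProbabilityMeasure P]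

/-- Second moment lower bound for the probability of a finite union. -/
theorem second_moment_le_measureReal_biUnion {ι : Type*} (s : Finset ι) {E : ι → Set Ω}
    (hE : ∀ i, MeasurableSet (E i)) (t : ℝ) :
    2 * t * ∑ i ∈ s, P.real (E i) - t ^ 2 * ∑ i ∈ s, ∑ j ∈ s, P.real (E i ∩ E j) ≤
      P.real (⋃ i ∈ s, E i) := by
  have hI : ∀ {A : Set Ω}, MeasurableSet A → Integrable (A.indicator (1 : Ω → ℝ)) P :=
    fun hA => (integrable_const (1 : ℝ)).indicator hA
  have hU : MeasurableSet (⋃ i ∈ s, E i) := s.measurableSet_biUnion fun i _ => hE i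
  have h1 : Integrable (fun ω => ∑ i ∈ s, (E i).indicator (1 : Ω → ℝ) ω) P :=
    integrable_finsetSum _ fun i _ => hI (hE i)
  have h2 : Integrable (fun ω => ∑ i ∈ s, ∑ j ∈ s, (E i ∩ E j).indicator (1 : Ω → ℝ) ω) P :=
    integrable_finsetSum _ fun i _ => integrable_finsetSum _ fun j _ => hI ((hE i).inter (hE j))
  -- Pointwise, with S the number of events that occur, 2 t S - (t S)² ≤ 1 by (1 - t S)² ≥ 0, and
  -- the left side is 0 off the union.
  have key : ∫ ω, (2 * t * ∑ i ∈ s, (E i).indicator (1 : Ω → ℝ) ω -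
      t ^ 2 * ∑ i ∈ s, ∑ j ∈ s, (E i ∩ E j).indicator (1 : Ω → ℝ) ω) ∂P ≤
      ∫ ω, (⋃ i ∈ s, E i).indicator (1 : Ω → ℝ) ω ∂P := by
    refine integral_mono ((h1.const_mul _).sub (h2.const_mul _)) (hI hU) fun ω => ?_
    have hsq : ∑ i ∈ s, ∑ j ∈ s, (E i ∩ E j).indicator (1 : Ω → ℝ) ω =
        (∑ i ∈ s, (E i).indicator (1 : Ω → ℝ) ω) ^ 2 := by
      rw [sq, Finset.sum_mul_sum]
      simp only [Set.inter_indicator_one, Pi.mul_apply]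
    simp only [hsq]
    by_cases hω : ω ∈ ⋃ i ∈ s, E i
    · rw [Set.indicator_of_mem hω, Pi.one_apply]
      nlinarith [sq_nonneg (1 - t * ∑ i ∈ s, (E i).indicator (1 : Ω → ℝ) ω)]
    · rw [Set.indicator_of_notMem hω, Finset.sum_eq_zero]
      · simp
      · intro i hi
        exact Set.indicator_of_notMem (fun h => hω (Set.mem_biUnion hi h)) _
  rw [integral_sub (h1.const_mul _) (h2.const_mul _), integral_const_mul, integral_const_mul,
    integral_finsetSum _ fun i _ => hI (hE i),
    integral_finsetSum _ fun i _ => integrable_finsetSum _ fun j _ => hI ((hE i).inter (hE j)),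
    integral_indicator_one hU] at key
  simp only [integral_indicator_one (hE _)] at key
  refine le_of_eq_of_le ?_ key
  congr 2
  refine Finset.sum_congr rfl fun i _ => ?_
  rw [integral_finsetSum _ fun j _ => hI ((hE i).inter (hE j))]
  exact Finset.sum_congr rfl fun j _ => (integral_indicator_one ((hE i).inter (hE j))).symm

/-- Events that are pairwise quasi-independent at distance at least `L`, and whose probabilities
sum to at least `1`, have a union of probability bounded below. -/
theorem le_measureReal_iUnion_of_quasiIndep {E : ℕ → Set Ω} (hE : ∀ k, MeasurableSet (E k))
    {C : ℝ} (hC : 0 ≤ C) {L : ℕ}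
    (hpair : ∀ j k, j + L ≤ k → P.real (E j ∩ E k) ≤ C * (P.real (E j) * P.real (E k)))
    {n : ℕ} (hn : 1 ≤ ∑ k ∈ Finset.range n, P.real (E k)) :
    1 / (C + 2 * L + 1) ≤ P.real (⋃ k, E k) := by
  set S := ∑ k ∈ Finset.range n, P.real (E k) with hS
  -- Pairs closer than L are bounded trivially by P(E_j); each j has at most 2 L such partners.
  have hpair' : ∀ j k, P.real (E j ∩ E k) ≤ C * (P.real (E j) * P.real (E k)) +
      if j < k + L ∧ k < j + L then P.real (E j) else 0 := by
    intro j k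
    have h0 : 0 ≤ C * (P.real (E j) * P.real (E k)) := by positivity
    split_ifs with h
    · have : P.real (E j ∩ E k) ≤ P.real (E j) := measureReal_mono Set.inter_subset_left
      linarith
    · rw [add_zero]
      rcases le_or_gt (j + L) k with h1 | h1
      · exact hpair j k h1
      · rw [Set.inter_comm, mul_comm (P.real (E j))]
        exact hpair k j (by omega)
  have hcard : ∀ j, ∑ k ∈ Finset.range n, (if j < k + L ∧ k < j + L then P.real (E j) else 0) ≤
      2 * L * P.real (E j) := by
    intro j
    rw [← Finset.sum_filter, Finset.sum_const, nsmul_eq_mul]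
    refine mul_le_mul_of_nonneg_right ?_ measureReal_nonneg
    have h1 : (Finset.range n).filter (fun k => j < k + L ∧ k < j + L) ⊆
        Finset.Ico (j + 1 - L) (j + L) := by
      intro k hk
      simp only [Finset.mem_filter, Finset.mem_Ico] at hk ⊢
      omega
    have h2 := Finset.card_le_card h1
    rw [Nat.card_Ico] at h2
    have h3 : ((Finset.range n).filter (fun k => j < k + L ∧ k < j + L)).card ≤ 2 * L := by omega
    exact_mod_cast h3
  have hdouble : ∑ j ∈ Finset.range n, ∑ k ∈ Finset.range n, P.real (E j ∩ E k) ≤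
      (C + 2 * L + 1) * S ^ 2 := by
    calc _ ≤ ∑ j ∈ Finset.range n, (C * (P.real (E j) * S) + 2 * L * P.real (E j)) := by
          refine Finset.sum_le_sum fun j _ => ?_
          refine (Finset.sum_le_sum fun k _ => hpair' j k).trans ?_
          rw [Finset.sum_add_distrib, ← Finset.mul_sum, ← Finset.mul_sum]
          linarith [hcard j]
      _ = C * S ^ 2 + 2 * L * S := by
          rw [Finset.sum_add_distrib, ← Finset.mul_sum, ← Finset.sum_mul, ← Finset.mul_sum]
          ring
      -- S ≥ 1 absorbs the linear term 2 L S into 2 L S².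
      _ ≤ _ := by
          have : (0 : ℝ) ≤ L := L.cast_nonneg
          nlinarith [mul_nonneg this (mul_nonneg (sub_nonneg.2 hn) (zero_le_one.trans hn))]
  have hD : 0 < C + 2 * L + 1 := by positivity
  have hS0 : 0 < S := by linarith
  -- With the double sum at most D S², where D = C + 2 L + 1, this t maximises 2 t S - t² D S²; the
  -- maximum is 1 / D. The + 1 keeps D positive.
  have h := second_moment_le_measureReal_biUnion (P := P) (Finset.range n) hE
    (1 / ((C + 2 * L + 1) * S))
  have hsub : P.real (⋃ k ∈ Finset.range n, E k) ≤ P.real (⋃ k, E k) :=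
    measureReal_mono (Set.iUnion₂_subset fun k _ => Set.subset_iUnion E k)
  refine le_trans (le_trans ?_ h) hsub
  rw [← hS]
  have h1 := mul_le_mul_of_nonneg_left hdouble (sq_nonneg (1 / ((C + 2 * L + 1) * S)))
  have h2 : (1 / ((C + 2 * L + 1) * S)) ^ 2 * ((C + 2 * L + 1) * S ^ 2) = 1 / (C + 2 * L + 1) := by
    field_simp
  have h3 : 2 * (1 / ((C + 2 * L + 1) * S)) * S = 2 * (1 / (C + 2 * L + 1)) := by
    field_simp
  linarith

/-- A form of the Kochen–Stone lemma. -/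
theorem measure_frequently_pos_of_quasiIndep {E : ℕ → Set Ω} (hE : ∀ k, MeasurableSet (E k))
    {C : ℝ} (hC : 0 ≤ C) {L K : ℕ}
    (hpair : ∀ j k, K ≤ j → j + L ≤ k →
      P.real (E j ∩ E k) ≤ C * (P.real (E j) * P.real (E k)))
    (hns : ¬ Summable fun k => P.real (E k)) :
    0 < P {ω | ∃ᶠ k in atTop, ω ∈ E k} := by
  -- Divergence survives deleting initial terms, so every tail union has the same lower bound, which
  -- passes to the limit by continuity from above.
  have hunion : ∀ M, ENNReal.ofReal (1 / (C + 2 * L + 1)) ≤ P (⋃ k, E (k + (M + K))) := by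
    intro M
    have hns' : ¬ Summable fun k => P.real (E (k + (M + K))) := fun h =>
      hns ((summable_nat_add_iff (M + K)).1 h)
    rw [not_summable_iff_tendsto_nat_atTop_of_nonneg fun _ => measureReal_nonneg] at hns'
    obtain ⟨n, hn⟩ := (hns'.eventually_ge_atTop 1).exists
    refine ENNReal.ofReal_le_of_le_toReal ?_
    exact le_measureReal_iUnion_of_quasiIndep (fun k => hE _) hC
      (fun j k hjk => hpair _ _ (by omega) (by omega)) hn
  have hset : {ω | ∃ᶠ k in atTop, ω ∈ E k} = ⋂ M, ⋃ k, E (k + (M + K)) := by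
    ext ω
    simp only [Set.mem_ofPred_eq, frequently_atTop, Set.mem_iInter, Set.mem_iUnion]
    constructor
    · intro h M
      obtain ⟨k, hk, hω⟩ := h (M + K)
      exact ⟨k - (M + K), by rwa [Nat.sub_add_cancel hk]⟩
    · intro h M
      obtain ⟨k, hω⟩ := h M
      exact ⟨_, by omega, hω⟩
  have hanti : Antitone fun M => ⋃ k, E (k + (M + K)) := by
    intro M M' hM ω hω
    simp only [Set.mem_iUnion] at hω ⊢
    obtain ⟨k, hk⟩ := hω
    exact ⟨k + (M' - M), by rwa [show k + (M' - M) + (M + K) = k + (M' + K) by omega]⟩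
  rw [hset, hanti.measure_iInter
    (fun M => (MeasurableSet.iUnion fun k => hE _).nullMeasurableSet) ⟨0, measure_ne_top _ _⟩]
  refine lt_of_lt_of_le ?_ (le_iInf hunion)
  rw [ENNReal.ofReal_pos]
  positivity

end SecondMoment

/-! ### Maxima of independent variables -/

section Maxima

variable {Ω : Type*}

/-- The maximum of the first `n` variables is infinitely often at most `a_n - (d + 1)` iff
infinitely often the first `levelStart p (m + d)` variables all lie below `m`. -/
theorem frequently_partialMax_le_iff {p : ℕ → ℝ} (hp_pos : ∀ i, 0 < p i) (hp : HasSum p 1)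
    (X : ℕ → Ω → ℕ) (d : ℕ) (ω : Ω) :
    (∃ᶠ n in atTop, (partialMax X n ω : ℤ) ≤ (levelA p n : ℤ) - ((d + 1 : ℕ) : ℤ)) ↔
      ∃ᶠ m in atTop, ∀ i < levelStart p (m + d), X i ω < m := by
  simp only [frequently_atTop]
  constructor
  · intro h M
    obtain ⟨n, hn, hle⟩ := h (levelStart p (M + d))
    have hn1 : 1 ≤ n := (levelStart_pos hp_pos hp _).trans hn
    have h1 := (le_levelA_iff hp_pos hp hn1 _).2 hn
    refine ⟨levelA p n - d, by omega, fun i hi => ?_⟩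
    rw [Nat.sub_add_cancel (by omega)] at hi
    have h2 := (le_levelA_iff hp_pos hp hn1 (levelA p n)).1 le_rfl
    have h3 : X i ω ≤ partialMax X n ω :=
      Finset.le_sup (f := fun i => X i ω) (Finset.mem_range.2 (by omega))
    omega
  · intro h M
    obtain ⟨K, hK⟩ := eventually_atTop.1 ((tendsto_levelStart hp_pos hp).eventually_ge_atTop M)
    -- Asking for K + 1 forces m > 0, needed for the supremum to be strictly below m even over an
    -- empty range.
    obtain ⟨m, hm, hX⟩ := h (K + 1)
    refine ⟨levelStart p (m + d), hK _ (by omega), ?_⟩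
    have h1 := (le_levelA_iff hp_pos hp (levelStart_pos hp_pos hp (m + d)) (m + d)).2 le_rfl
    have h2 : partialMax X (levelStart p (m + d)) ω < m :=
      (Finset.sup_lt_iff (by rw [Nat.bot_eq_zero]; omega)).2
        fun i hi => hX i (Finset.mem_range.1 hi)
    omega

variable [MeasurableSpace Ω] {P : Measure Ω} {X : ℕ → Ω → ℕ}

theorem measurableSet_forall_lt (hX : ∀ i, Measurable (X i)) (N m : ℕ) :
    MeasurableSet {ω | ∀ i < N, X i ω < m} := by
  simp only [Set.ofPred_forall]
  exact MeasurableSet.iInter fun i => MeasurableSet.iInter fun _ => measurableSet_lt (hX i)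
    measurable_const

/-- The zero-one law for the event that the first `N m` variables lie below `m`
infinitely often. -/
theorem measure_frequently_forall_lt_eq_zero_or_one (hX : ∀ i, Measurable (X i))
    (hindep : iIndepFun X P) (N : ℕ → ℕ) :
    P {ω | ∃ᶠ m in atTop, ∀ i < N m, X i ω < m} = 0 ∨
      P {ω | ∃ᶠ m in atTop, ∀ i < N m, X i ω < m} = 1 := by
  refine measure_zero_or_one_of_measurableSet_limsup_atTop
    (s := fun i => MeasurableSpace.comap (X i) inferInstance) (fun i => (hX i).comap_le)
    ((iIndepFun_iff_iIndep _ _ _).1 hindep) ?_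
  rw [limsup_eq_iInf_iSup_of_nat, MeasurableSpace.measurableSet_iInf]
  intro n
  have hset : {ω | ∃ᶠ m in atTop, ∀ i < N m, X i ω < m} =
      ⋂ M : ℕ, ⋃ m ≥ M, ⋂ i ≥ n, ⋂ _ : i < N m, {ω | X i ω < m} := by
    ext ω
    -- For fixed ω the first n variables lie below every large m, so they do not affect the event,
    -- which is therefore a tail event.
    have h1 : ∀ᶠ m in atTop, ((∀ i < N m, X i ω < m) ↔ ∀ i ≥ n, i < N m → X i ω < m) := by
      filter_upwards [eventually_gt_atTop ((Finset.range n).sup fun i => X i ω)] with m hm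
      refine ⟨fun h i _ hi => h i hi, fun h i hi => ?_⟩
      rcases lt_or_ge i n with hin | hin
      · exact lt_of_le_of_lt (Finset.le_sup (f := fun i => X i ω) (Finset.mem_range.2 hin)) hm
      · exact h i hin hi
    rw [Set.mem_ofPred_eq, frequently_congr h1]
    simp only [Set.mem_ofPred_eq, frequently_atTop, Set.mem_iInter, Set.mem_iUnion, exists_prop]
  rw [hset]
  refine MeasurableSet.iInter fun M => MeasurableSet.iUnion fun m => MeasurableSet.iUnion fun _ =>
    MeasurableSet.iInter fun i => MeasurableSet.iInter fun hi => MeasurableSet.iInter fun _ => ?_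
  have hle : MeasurableSpace.comap (X i) inferInstance ≤
      ⨆ i ≥ n, MeasurableSpace.comap (X i) inferInstance :=
    le_iSup₂ (f := fun i (_ : i ≥ n) => MeasurableSpace.comap (X i) inferInstance) i hi
  exact hle _ ⟨Set.Iio m, measurableSet_Iio, rfl⟩

variable [IsProbabilityMeasure P] {p : ℕ → ℝ}

theorem measureReal_lt (hp_pos : ∀ i, 0 < p i) (hp : HasSum p 1) (hX : ∀ i, Measurable (X i))
    (hX_law : ∀ i k : ℕ, P {ω | X i ω = k} = ENNReal.ofReal (p k)) (i m : ℕ) :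
    P.real (X i ⁻¹' Set.Iio m) = 1 - tail p m := by
  have h : P.real (X i ⁻¹' Set.Iio m) = ∑ k ∈ Finset.range m, P.real (X i ⁻¹' {k}) := by
    rw [sum_measureReal_preimage_singleton _ fun k _ => hX i (measurableSet_singleton k)]
    simp
  have h' : ∀ k, P.real (X i ⁻¹' {k}) = p k := fun k => by
    have := hX_law i k
    rw [Measure.real, show X i ⁻¹' {k} = {ω | X i ω = k} from rfl, this,
      ENNReal.toReal_ofReal (hp_pos k).le]
  rw [h]
  simp only [h']
  linarith [sum_range_add_tail hp m]

theorem measureReal_forall_lt (hp_pos : ∀ i, 0 < p i) (hp : HasSum p 1)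
    (hX : ∀ i, Measurable (X i)) (hindep : iIndepFun X P)
    (hX_law : ∀ i k : ℕ, P {ω | X i ω = k} = ENNReal.ofReal (p k)) (N : ℕ) (b : ℕ → ℕ) :
    P.real {ω | ∀ i < N, X i ω < b i} = ∏ i ∈ Finset.range N, (1 - tail p (b i)) := by
  have h := hindep.measure_inter_preimage_eq_mul (Finset.range N)
    (sets := fun i => Set.Iio (b i)) fun i _ => measurableSet_Iio
  have hset : {ω | ∀ i < N, X i ω < b i} = ⋂ i ∈ Finset.range N, X i ⁻¹' Set.Iio (b i) := by
    ext ω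
    simp
  rw [hset, Measure.real, h, ENNReal.toReal_prod]
  exact Finset.prod_congr rfl fun i _ => measureReal_lt hp_pos hp hX hX_law i (b i)

theorem measureReal_forall_lt_const (hp_pos : ∀ i, 0 < p i) (hp : HasSum p 1)
    (hX : ∀ i, Measurable (X i)) (hindep : iIndepFun X P)
    (hX_law : ∀ i k : ℕ, P {ω | X i ω = k} = ENNReal.ofReal (p k)) (N m : ℕ) :
    P.real {ω | ∀ i < N, X i ω < m} = (1 - tail p m) ^ N := by
  rw [measureReal_forall_lt hp_pos hp hX hindep hX_law N fun _ => m]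
  simp

/-- As m ≤ m', the first N variables only feel the bound m and the next e only m', so the
intersection splits into independent blocks. -/
theorem measureReal_forall_lt_inter (hp_pos : ∀ i, 0 < p i) (hp : HasSum p 1)
    (hX : ∀ i, Measurable (X i)) (hindep : iIndepFun X P)
    (hX_law : ∀ i k : ℕ, P {ω | X i ω = k} = ENNReal.ofReal (p k))
    {m m' : ℕ} (hm : m ≤ m') (N e : ℕ) :
    P.real ({ω | ∀ i < N, X i ω < m} ∩ {ω | ∀ i < N + e, X i ω < m'}) =
      (1 - tail p m) ^ N * (1 - tail p m') ^ e := by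
  have hset : {ω | ∀ i < N, X i ω < m} ∩ {ω | ∀ i < N + e, X i ω < m'} =
      {ω | ∀ i < N + e, X i ω < if i < N then m else m'} := by
    ext ω
    simp only [Set.mem_inter_iff, Set.mem_ofPred_eq]
    constructor
    · rintro ⟨h, h'⟩ i hi
      split_ifs with hiN
      · exact h i hiN
      · exact h' i hi
    · intro h
      refine ⟨fun i hi => by simpa [hi] using h i (by omega), fun i hi => ?_⟩
      have := h i hi
      split_ifs at this <;> omega
  rw [hset, measureReal_forall_lt hp_pos hp hX hindep hX_law _ fun i => if i < N then m else m',
    Finset.prod_range_add]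
  congr 1
  · rw [Finset.prod_congr rfl fun i hi => by rw [if_pos (Finset.mem_range.1 hi)]]
    simp
  · simp

/-- By the zero-one law positivity suffices. P(A_j ∩ A_k) lacks only the factor (1 - t_k)^{n_{j+d}}
compared with P(A_j) P(A_k), and j + d ≤ k keeps this factor above exp(-4). -/
theorem measure_frequently_forall_lt_eq_one (hp_pos : ∀ i, 0 < p i) (hp : HasSum p 1)
    (hX : ∀ i, Measurable (X i)) (hindep : iIndepFun X P)
    (hX_law : ∀ i k : ℕ, P {ω | X i ω = k} = ENNReal.ofReal (p k)) (d : ℕ)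
    (hns : ¬ Summable fun m => (1 - tail p m) ^ levelStart p (m + d)) :
    P {ω | ∃ᶠ m in atTop, ∀ i < levelStart p (m + d), X i ω < m} = 1 := by
  refine (measure_frequently_forall_lt_eq_zero_or_one hX hindep
    fun m => levelStart p (m + d)).resolve_left (ne_of_gt ?_)
  obtain ⟨K, hK⟩ := eventually_atTop.1
    ((tendsto_tail_zero p).eventually_le_const (by norm_num : (0 : ℝ) < 1 / 2))
  have hprob := fun m => measureReal_forall_lt_const hp_pos hp hX hindep hX_law
    (levelStart p (m + d)) m
  refine measure_frequently_pos_of_quasiIndep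
    (E := fun m => {ω | ∀ i < levelStart p (m + d), X i ω < m})
    (fun m => measurableSet_forall_lt hX _ m) (Real.exp_nonneg 4) (L := d) (K := K)
    (fun j k hj hjk => ?_) (by simpa only [hprob] using hns)
  obtain ⟨e, he⟩ := Nat.exists_eq_add_of_le
    (levelStart_mono hp_pos hp (show j + d ≤ k + d by omega))
  rw [hprob, hprob, he, measureReal_forall_lt_inter hp_pos hp hX hindep hX_law (by omega), pow_add]
  have hk := hK k (by omega)
  have h1 := exp_neg_four_le_one_sub_tail_pow hp_pos hp hjk hk
  have h2 : 0 ≤ (1 - tail p j) ^ levelStart p (j + d) * (1 - tail p k) ^ e :=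
    mul_nonneg (pow_nonneg (by linarith [tail_le_one hp_pos hp j]) _)
      (pow_nonneg (by linarith) _)
  have h3 : 1 ≤ Real.exp 4 * (1 - tail p k) ^ levelStart p (j + d) := by
    have := mul_le_mul_of_nonneg_left h1 (Real.exp_nonneg 4)
    rwa [← Real.exp_add, add_neg_cancel, Real.exp_zero] at this
  nlinarith [mul_le_mul_of_nonneg_right h3 h2]

theorem measure_frequently_forall_lt_eq_zero (hp_pos : ∀ i, 0 < p i) (hp : HasSum p 1)
    (hX : ∀ i, Measurable (X i)) (hindep : iIndepFun X P)
    (hX_law : ∀ i k : ℕ, P {ω | X i ω = k} = ENNReal.ofReal (p k)) (d : ℕ)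
    (hs : Summable fun m => (1 - tail p m) ^ levelStart p (m + d)) :
    P {ω | ∃ᶠ m in atTop, ∀ i < levelStart p (m + d), X i ω < m} = 0 := by
  refine measure_setOfPred_frequently_eq_zero
    (p := fun m ω => ∀ i < levelStart p (m + d), X i ω < m) ?_
  have h : ∀ m, P {ω | ∀ i < levelStart p (m + d), X i ω < m} =
      ENNReal.ofReal ((1 - tail p m) ^ levelStart p (m + d)) := fun m => by
    rw [← measureReal_forall_lt_const hp_pos hp hX hindep hX_law, ofReal_measureReal]
  simp only [h]
  exact hs.tsum_ofReal_ne_top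

end Maxima

theorem theorem2 {Ω : Type*} [MeasurableSpace Ω] (P : Measure Ω) [IsProbabilityMeasure P]
    (p : ℕ → ℝ) (hp_pos : ∀ i, 0 < p i) (hp_sum : HasSum p 1)
    (X : ℕ → Ω → ℕ) (hX_meas : ∀ i, Measurable (X i))
    (hX_indep : iIndepFun X P)
    (hX_law : ∀ i k : ℕ, P {ω | X i ω = k} = ENNReal.ofReal (p k))
    (hr_mono : MonotoneOn (smallR p) (Set.Ici 1))
    (hr_tendsto : Tendsto (smallR p) atTop atTop)
    (l : ℕ) (hl : 1 ≤ l) :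
    (l = 1 →
      P {ω | ∃ᶠ n in atTop, (partialMax X n ω : ℤ) ≤ (levelA p n : ℤ) - (l : ℤ)} = 1) ∧
    (1 < l →
      ((Summable fun k : ℕ => Real.exp (-Real.exp (((l : ℝ) - 1) * smallR p (k + 1)))) →
        P {ω | ∃ᶠ n in atTop, (partialMax X n ω : ℤ) ≤ (levelA p n : ℤ) - (l : ℤ)} = 0) ∧
      ((¬ Summable fun k : ℕ => Real.exp (-Real.exp (((l : ℝ) - 1) * smallR p (k + 1)))) →
        P {ω | ∃ᶠ n in atTop, (partialMax X n ω : ℤ) ≤ (levelA p n : ℤ) - (l : ℤ)} = 1)) := by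
  obtain ⟨d, rfl⟩ : ∃ d, l = d + 1 := ⟨l - 1, by omega⟩
  have hd : (((d + 1 : ℕ) : ℝ) - 1) = d := by push_cast; ring
  simp only [frequently_partialMax_le_iff hp_pos hp_sum X d, hd]
  refine ⟨fun h => ?_, fun h => ⟨fun hs => ?_, fun hns => ?_⟩⟩
  · obtain rfl : d = 0 := by omega
    refine measure_frequently_forall_lt_eq_one hp_pos hp_sum hX_meas hX_indep hX_law 0 fun hs => ?_
    -- For d = 0 the terms are eventually at least exp(-4), so they cannot tend to 0.
    have h1 := hs.tendsto_atTop_zero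
    refine absurd (ge_of_tendsto h1 ?_) (not_le.2 (Real.exp_pos (-4)))
    filter_upwards [(tendsto_tail_zero p).eventually_le_const (by norm_num : (0 : ℝ) < 1 / 2)]
      with m hm
    exact exp_neg_four_le_one_sub_tail_pow hp_pos hp_sum le_rfl hm
  · refine measure_frequently_forall_lt_eq_zero hp_pos hp_sum hX_meas hX_indep hX_law d
      (hs.of_nonneg_of_le (fun m => pow_nonneg ?_ _)
        fun m => one_sub_tail_pow_le hp_pos hp_sum hr_mono m d)
    linarith [tail_le_one hp_pos hp_sum m]
  · exact measure_frequently_forall_lt_eq_one hp_pos hp_sum hX_meas hX_indep hX_law d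
      (not_summable_one_sub_tail_pow hp_pos hp_sum hr_mono hr_tendsto (by omega) hns)
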